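/- Notation. Let $d\in\mathbb N$ and equip $\mathbb{R}^d$ with its Euclidean norm; "smooth" means $C^2$. For $A\subset\mathbb{R}^d$ write $d_A(x)=\inf_{a\in A}\|x-a\|$ (with $\inf\emptyset=+\infty$). For $X\subset\mathbb{R}^d$ put $\overline{\complement} X=\overline{\mathbb{R}^d\setminus X}$ and, for $r>0$, $X^{-r}=\{x : d_{\overline{\complement} X}(x)\ge r\}$. The Clarke gradient $\partial^*\varphi(x)$ of a locally Lipschitz $\varphi:\mathbb{R}^d\to\mathbb{R}$ is the convex hull of all limits $\lim_n\nabla\varphi(x_n)$ with $x_n\to x$ and $\varphi$ differentiable at each $x_n$. For $\mu\in(0,1]$, $\mathrm{reach}_\mu(X)$ is the supremum of the $s\geq 0$ such that every element of $\partial^* d_X(x)$ has norm at least $\mu$ whenever $0<d_X(x)\le s$. The number $\mathrm{reach}(A)$ is the supremum of the $t \geq 0$ such that every $x$ with $d_A(x)<t$ has a unique closest point in $A$. A compact set $X\subset\mathbb{R}^d$ is *complementary regular* if $\overline{\mathrm{int}\,X}=X$, $\mathrm{reach}_\mu(X)>0$ for some $\mu\in(0,1]$, and $\mathrm{reach}(\overline{\complement}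 X)>0$. For $x\in A$, $\mathrm{Tan}(A,x)$ is the cone generated by the limits of $\frac{x_n-x}{\|x_n-x\|}$ with $x_n\in A\setminus\{x\}$, $x_n\to x$. For $X$ complementary regular, let $\mathrm{Nor}(X,x)=-\{u:\langle u,b\rangle\le 0\ \ \forall b\in \mathrm{Tan}(\overline{\complement} X,x)\}$ if $x\in\partial X$ and $\mathrm{Nor}(X,x)=\{0\}$ if $x$ is an interior point of $X$. Given $f:\mathbb{R}^d\to\mathbb{R}$ of class $C^2$, a point $x\in X$ is a *critical point* of $f_{|X}$ if $\nabla f(x)\in-\mathrm{Nor}(X,x)$, and $c\in\mathbb{R}$ is a *regular value* of $f_{|X}$ if $f^{-1}(c)$ contains no critical point of $f_{|X}$. Statement (homotopy equivalence). Let $X\subset\mathbb{R}^d$ be complementary regular, let $f:\mathbb{R}^d\to\mathbb{R}$ be $C^2$, let $c$ be a regular value of $f_{|X}$, and let $\eta:\mathbb{R}^d\to\mathbb{R}^d$ be $C^2$ with $\|\eta(x)\|\le 1$ for all $x$. Put $f_r(x)=f(x+r\eta(x))$. Then there is $r_0>0$ such that for all $0<r<r_0$ the set $X^{-r}\cap f_r^{-1}(-\infty,c]$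 is homotopy equivalent to $X_c=X\cap f^{-1}(-\infty,c]$ (both with the topology induced by $\mathbb{R}^d$). -/

import Mathlib

open Set Filter Topology

open scoped ENNReal

noncomputable section

namespace ComplReg

variable {d : ℕ}

/-- The complement set of `X`: the closure of the set-theoretic complement. -/
def cl_compl (X : Set (EuclideanSpace ℝ (Fin d))) : Set (EuclideanSpace ℝ (Fin d)) :=
  closure Xᶜ

/-- The counter-offset `X^{-r}`, the set of points at distance at least `r` from the complement set.
The distance is extended-real-valued, so that the distance to the empty set is `∞`. -/
def counterOffset (X : Set (EuclideanSpace ℝ (Fin d))) (r : ℝ) :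
    Set (EuclideanSpace ℝ (Fin d)) :=
  {x | ENNReal.ofReal r ≤ Metric.infEDist x (cl_compl X)}

/-- The Clarke gradient of `φ` at `x`: the convex hull of the limits of `∇ φ (u n)` along
sequences `u n → x` of points of differentiability of `φ`. -/
def clarke (φ : EuclideanSpace ℝ (Fin d) → ℝ) (x : EuclideanSpace ℝ (Fin d)) :
    Set (EuclideanSpace ℝ (Fin d)) :=
  convexHull ℝ {v | ∃ u : ℕ → EuclideanSpace ℝ (Fin d), Tendsto u atTop (𝓝 x) ∧
    (∀ n, DifferentiableAt ℝ φ (u n)) ∧ Tendsto (fun n => gradient φ (u n)) atTop (𝓝 v)}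

/-- `Δ(A)`, the infimum of the norms of the elements of `A`. -/
def minNorm (A : Set (EuclideanSpace ℝ (Fin d))) : ℝ := Metric.infDist 0 A

/-- The `μ`-reach of `X`: the supremum of the `s` such that `Δ(∂* d_X (x)) ≥ μ` at every point `x`
with `0 < d_X(x) ≤ s`. -/
def muReach (μ : ℝ) (X : Set (EuclideanSpace ℝ (Fin d))) : ℝ≥0∞ :=
  sSup {s | ∀ x, 0 < Metric.infEDist x X → Metric.infEDist x X ≤ s →
    μ ≤ minNorm (clarke (fun y => Metric.infDist y X) x)}

/-- The reach of `A`: the largest `t` such that every point at distance less than `t`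
from `A` has a unique closest point in `A`. -/
def reach (A : Set (EuclideanSpace ℝ (Fin d))) : ℝ≥0∞ :=
  sSup {t | ∀ x, Metric.infEDist x A < t → ∃! a, a ∈ A ∧ dist x a = Metric.infDist x A}

/-- Complementary regular sets. -/
structure IsComplementaryRegular (X : Set (EuclideanSpace ℝ (Fin d))) : Prop where
  isCompact : IsCompact X
  closure_interior : closure (interior X) = X
  muReach_pos : ∃ μ : ℝ, 0 < μ ∧ μ ≤ 1 ∧ 0 < muReach μ X
  reach_compl_pos : 0 < reach (cl_compl X)

/-- The polar cone `{u | ⟪u, b⟫ ≤ 0 for all b ∈ B}`. -/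
def polarCone (B : Set (EuclideanSpace ℝ (Fin d))) : Set (EuclideanSpace ℝ (Fin d)) :=
  {u | ∀ b ∈ B, inner ℝ u b ≤ 0}

/-- The polar of the (one-sided) tangent cone; this is the normal cone of a set
with positive reach. -/
def tangentPolar (A : Set (EuclideanSpace ℝ (Fin d))) (x : EuclideanSpace ℝ (Fin d)) :
    Set (EuclideanSpace ℝ (Fin d)) :=
  polarCone (posTangentConeAt A x)

open Classical in
/-- The normal cone, at a point `x` of `X`, of a set `X` whose complement set has positive reach.
At boundary points it is the opposite of the normal cone of the complement set; at interior
points (where the tangent cone of `X` is the whole space) it is `{0}`. -/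
def normalCone (X : Set (EuclideanSpace ℝ (Fin d))) (x : EuclideanSpace ℝ (Fin d)) :
    Set (EuclideanSpace ℝ (Fin d)) :=
  if x ∈ frontier X then {v | -v ∈ tangentPolar (cl_compl X) x} else {0}

/-- `x` is a critical point of `f` restricted to `X`: `x ∈ X` and `∇ f (x) ∈ -Nor(X, x)`. -/
def IsCriticalPt (f : EuclideanSpace ℝ (Fin d) → ℝ) (X : Set (EuclideanSpace ℝ (Fin d)))
    (x : EuclideanSpace ℝ (Fin d)) : Prop :=
  x ∈ X ∧ -gradient f x ∈ normalCone X x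

/-- `c` is a regular value of `f` restricted to `X`: no critical point has value `c`. -/
def IsRegularValue (f : EuclideanSpace ℝ (Fin d) → ℝ) (X : Set (EuclideanSpace ℝ (Fin d)))
    (c : ℝ) : Prop :=
  ∀ x, f x = c → ¬ IsCriticalPt f X x

/-- `f_r : x ↦ f (x + r η(x))`. -/
def shifted (f : EuclideanSpace ℝ (Fin d) → ℝ)
    (η : EuclideanSpace ℝ (Fin d) → EuclideanSpace ℝ (Fin d)) (r : ℝ) :
    EuclideanSpace ℝ (Fin d) → ℝ :=
  fun x => f (x + r • η x)

/-- The sublevel set `X_c = X ∩ f⁻¹(-∞, c]`. -/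
def sublevel (X : Set (EuclideanSpace ℝ (Fin d))) (f : EuclideanSpace ℝ (Fin d) → ℝ) (c : ℝ) :
    Set (EuclideanSpace ℝ (Fin d)) :=
  X ∩ f ⁻¹' Iic c

end ComplReg

end

/-! Let `Y` be the closure of the complement of `X`, `R` a positive real such that every point
closer than `R` to `Y` projects uniquely to it, and `τ = R / 2`. Such a point at distance in `(0,
τ]` from `Y` leaves its projection `p` along a unit vector `n` for which the open `τ`-ball tangent
at `p` misses `Y` (`mem_proxNormal_of_unique`). Moving transversally to these proximal normals
therefore makes the distance to `Y` grow linearly.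

Each hypothesis supplies a piece of transversality at a point of `X`. Positive `μ`-reach keeps `0`
out of the convex hull of the proximal normals: otherwise tangent balls inside `X` would lie on all
sides and the distance to `X` would be quadratically small, whereas its slope is bounded below
(`zero_notMem_convexHull_proxNormal`). Regularity of `c` says that `∇f` is not in the polar of the
tangent cone of `Y`, which contains the proximal normals. Separating `0` from the hull of the
normals and `-∇f` gives a direction that enters `X` and decreases `f`
(`exists_transverse_direction`).

These conditions are convex and open, so they glue to a continuous field `w`, with uniform bounds
near the compact set `X_c`. No flow is needed: along the straight displacements `x + t • w x` the
distance to `Y` grows, and `f` and `f_r` drop when `f x` is close to `c`, all at rate at least `δ /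
2`. The two sets differ by errors of order `r` in both quantities, so a time `T = κ * r` suffices to
carry each set into the other, and neither is left on the way. The two time-`T` displacements are
then homotopy inverse (`nonempty_homotopyEquiv_of_displacement`). -/

namespace ComplReg

/-! ### Growth of distance functions and proximal normals -/

section DistanceFunction

variable {E : Type*} [NormedAddCommGroup E] [InnerProductSpace ℝ E]

/-- The unit vectors `n` such that the open ball of radius `τ` tangent to `n` at `p` misses `Y`. -/
def proxNormal (Y : Set E) (τ : ℝ) (p : E) : Set E :=
  {n | ‖n‖ = 1 ∧ ∀ y ∈ Y, 2 * τ * inner ℝ n (y - p) ≤ ‖y - p‖ ^ 2}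

/-- The graph of the proximal normals is closed. -/
theorem mem_proxNormal_of_tendsto {Y : Set E} {τ : ℝ} {ι : Type*} {l : Filter ι} [l.NeBot]
    {p n : ι → E} {p₀ n₀ : E} (hp : Tendsto p l (𝓝 p₀)) (hn : Tendsto n l (𝓝 n₀))
    (h : ∀ᶠ i in l, n i ∈ proxNormal Y τ (p i)) : n₀ ∈ proxNormal Y τ p₀ := by
  refine ⟨tendsto_nhds_unique (hn.norm) (tendsto_const_nhds.congr' ?_), fun y hy => ?_⟩
  · filter_upwards [h] with i hi using hi.1.symm
  · refine le_of_tendsto_of_tendsto ((hn.inner (tendsto_const_nhds.sub hp)).const_mul (2 * τ))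
      ((tendsto_const_nhds.sub hp).norm.pow 2) ?_
    filter_upwards [h] with i hi using hi.2 y hy

variable [ProperSpace E]

/-- If `w` makes an angle bounded away from the right angle with all the directions from the
closest points of `A` to `z`, then the distance to `A` grows linearly along `z + t • w`. -/
theorem infDist_add_smul_ge {A : Set E} (hA : IsClosed A) (hne : A.Nonempty) {z w : E}
    {α' α : ℝ} (hz : 0 < Metric.infDist z A) (hα : α' < α)
    (H : ∀ p ∈ A, dist z p = Metric.infDist z A →
      α * Metric.infDist z A ≤ inner ℝ w (z - p)) :
    ∃ ε > 0, ∀ t, 0 ≤ t → t ≤ ε →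
      Metric.infDist z A + α' * t ≤ Metric.infDist (z + t • w) A := by
  set D := Metric.infDist z A with hD
  -- `C` collects the points of `A` seen from `z` in a bad direction. It is closed and contains no
  -- closest point, so it lies at distance at least some `m > D`, and closest points to nearby `z +
  -- t • w` avoid it.
  set C : Set E := {p | p ∈ A ∧ inner ℝ w (z - p) ≤ α' * ‖z - p‖} with hC
  have hCc : IsClosed C := hA.inter (isClosed_le
    (f := fun p => inner ℝ w (z - p)) (g := fun p => α' * ‖z - p‖) (by fun_prop) (by fun_prop))
  obtain ⟨m, hDm, hm⟩ : ∃ m, D < m ∧ ∀ p ∈ C, m ≤ dist z p := by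
    rcases C.eq_empty_or_nonempty with h0 | h0
    · exact ⟨D + 1, by linarith, by simp [h0]⟩
    · obtain ⟨p, hp, hpd⟩ := hCc.exists_infDist_eq_dist h0 z
      refine ⟨dist z p, lt_of_le_of_ne (Metric.infDist_le_dist_of_mem hp.1) fun h => ?_,
        fun q hq => hpd ▸ Metric.infDist_le_dist_of_mem hq⟩
      have h1 := H p hp.1 h.symm
      have h2 := hp.2
      rw [← dist_eq_norm, ← h] at h2
      nlinarith
  have hw := norm_nonneg w
  -- A closest point to `z + t • w` is within `D + 2 * t * ‖w‖` of `z`; this bound on `t` keeps that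
  -- below `m`.
  refine ⟨(m - D) / (4 * (‖w‖ + 1)), by apply div_pos <;> linarith, fun t ht0 ht => ?_⟩
  rw [le_div_iff₀ (by positivity)] at ht
  obtain ⟨q, hq, hqd⟩ := hA.exists_infDist_eq_dist hne (z + t • w)
  have hzw : dist z (z + t • w) = t * ‖w‖ := by
    rw [dist_self_add_right, norm_smul, Real.norm_of_nonneg ht0]
  have h1 : dist z q < m := by
    have h2 := dist_triangle z (z + t • w) q
    have h3 : Metric.infDist (z + t • w) A ≤ D + dist (z + t • w) z :=
      Metric.infDist_le_infDist_add_dist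
    rw [dist_comm, hzw] at h3
    rw [hzw, ← hqd] at h2
    nlinarith
  have h2 : α' * ‖z - q‖ < inner ℝ w (z - q) := by
    by_contra h
    exact absurd (hm q ⟨hq, not_lt.1 h⟩) (not_le.2 h1)
  have h3 : D ≤ ‖z - q‖ := dist_eq_norm z q ▸ Metric.infDist_le_dist_of_mem hq
  have h4 : inner ℝ (z + t • w - q) (z - q) ≤ ‖z + t • w - q‖ * ‖z - q‖ := real_inner_le_norm _ _
  have h5 : inner ℝ (z + t • w - q) (z - q) = ‖z - q‖ ^ 2 + t * inner ℝ w (z - q) := by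
    rw [show z + t • w - q = (z - q) + t • w by abel, inner_add_left, real_inner_self_eq_norm_sq,
      real_inner_smul_left]
  rw [hqd, dist_eq_norm]
  have h6 : (‖z - q‖ + α' * t) * ‖z - q‖ ≤ ‖z + t • w - q‖ * ‖z - q‖ := by
    nlinarith
  have := le_of_mul_le_mul_right h6 (by linarith)
  linarith

/-- If the distance to `A` has slope at least `μ > μ'` at all the points of a ball, some point of
the sphere is farther from `A` than the centre by `μ' * h`. -/
theorem exists_dist_eq_infDist_ge {A : Set E} (hA : IsClosed A) (hne : A.Nonempty) {x : E}
    {h μ' μ : ℝ} (hh : 0 ≤ h) (hx : 0 < Metric.infDist x A) (hμ' : 0 ≤ μ') (hμ : μ' < μ)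
    (H : ∀ z, dist z x < h → 0 < Metric.infDist z A → ∃ w : E, ‖w‖ = 1 ∧
      ∀ p ∈ A, dist z p = Metric.infDist z A → μ * Metric.infDist z A ≤ inner ℝ w (z - p)) :
    ∃ z, dist z x = h ∧ Metric.infDist x A + μ' * h ≤ Metric.infDist z A := by
  -- Penalised maximisation: at a maximum inside the open ball, the distance would still grow at
  -- rate `(μ' + μ) / 2 > μ'` in some unit direction, beating the penalty. So the maximum is on the
  -- sphere.
  obtain ⟨z, hz, hmax⟩ := (isCompact_closedBall x h).exists_isMaxOn ⟨x, by simpa using hh⟩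
    (f := fun z => Metric.infDist z A - μ' * dist z x) (by fun_prop)
  have h0 : Metric.infDist x A ≤ Metric.infDist z A - μ' * dist z x := by
    simpa using hmax (show x ∈ Metric.closedBall x h by simpa using hh)
  rcases (Metric.mem_closedBall.1 hz).lt_or_eq with hlt | heq
  · exfalso
    have hz0 : 0 < Metric.infDist z A := by
      have := mul_nonneg hμ' (dist_nonneg (x := z) (y := x)); linarith
    obtain ⟨w, hw, hwp⟩ := H z hlt hz0
    obtain ⟨ε, hε, hgrow⟩ := infDist_add_smul_ge hA hne hz0
      (show (μ' + μ) / 2 < μ by linarith) hwp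
    set t := min ε (h - dist z x) with ht
    have htpos : 0 < t := lt_min hε (by linarith)
    have hd : dist (z + t • w) z = t := by
      simp [norm_smul, hw, abs_of_pos htpos]
    have htri := dist_triangle (z + t • w) z x
    rw [hd] at htri
    have h1 := hgrow t htpos.le (min_le_left _ _)
    have h2 : z + t • w ∈ Metric.closedBall x h := by
      rw [Metric.mem_closedBall]
      have := min_le_right ε (h - dist z x)
      linarith
    have h3 := hmax h2
    simp only [mem_ofPred_eq] at h3
    nlinarith
  · exact ⟨z, heq, by rw [heq] at h0; linarith⟩

/-- In a set with uniform unique projections up to distance `R`, the balls witnessing the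
projections can be enlarged up to radius `R`. -/
theorem mem_proxNormal_of_unique {Y : Set E} (hY : IsClosed Y) {R τ : ℝ}
    (hR : ∀ x, Metric.infDist x Y < R → ∃! a, a ∈ Y ∧ dist x a = Metric.infDist x Y)
    (hτR : τ < R) {x p : E} (hx : 0 < Metric.infDist x Y) (hxτ : Metric.infDist x Y ≤ τ)
    (hp : p ∈ Y) (hpx : dist x p = Metric.infDist x Y) :
    (Metric.infDist x Y)⁻¹ • (x - p) ∈ proxNormal Y τ p := by
  have hne : Y.Nonempty := ⟨p, hp⟩
  set D := Metric.infDist x Y with hD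
  have hnD : ‖x - p‖ = D := by rw [← dist_eq_norm, hpx]
  have hn1 : ‖D⁻¹ • (x - p)‖ = 1 := by
    rw [norm_smul, hnD, norm_inv, Real.norm_of_nonneg hx.le, inv_mul_cancel₀ hx.ne']
  -- Unique projection gives slope `1`, hence every gain rate `μ' < 1` is attained on the sphere of
  -- radius `τ - D`; compactness of the sphere upgrades this to the full gain `τ - D`.
  obtain ⟨z, hzx, hz⟩ : ∃ z, dist z x = τ - D ∧ τ ≤ Metric.infDist z Y := by
    have key : ∀ μ' : ℝ, 0 ≤ μ' → μ' < 1 → ∃ z ∈ Metric.sphere x (τ - D),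
        D + μ' * (τ - D) ≤ Metric.infDist z Y := by
      intro μ' h0 h1
      obtain ⟨z, hz1, hz2⟩ := exists_dist_eq_infDist_ge hY hne (h := τ - D) (by linarith) hx h0 h1
        (fun z hz hz0 => by
          have hzR : Metric.infDist z Y < R := by
            have : Metric.infDist z Y ≤ D + dist z x := Metric.infDist_le_infDist_add_dist
            linarith
          obtain ⟨a, ⟨haY, had⟩, hu⟩ := hR z hzR
          have hna : ‖z - a‖ = Metric.infDist z Y := by rw [← dist_eq_norm, had]
          refine ⟨(Metric.infDist z Y)⁻¹ • (z - a), ?_, fun q hq hqd => ?_⟩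
          · rw [norm_smul, hna, norm_inv, Real.norm_of_nonneg hz0.le, inv_mul_cancel₀ hz0.ne']
          · rw [hu q ⟨hq, hqd⟩, real_inner_smul_left, real_inner_self_eq_norm_sq, hna, sq,
              inv_mul_cancel_left₀ hz0.ne', one_mul])
      exact ⟨z, hz1, hz2⟩
    obtain ⟨z₁, hz₁, -⟩ := key 0 le_rfl one_pos
    obtain ⟨z, hz, hmax⟩ := (isCompact_sphere x (τ - D)).exists_isMaxOn ⟨z₁, hz₁⟩
      (f := fun z => Metric.infDist z Y) (by fun_prop)
    refine ⟨z, hz, ?_⟩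
    by_contra hlt
    push Not at hlt
    have hpos : 0 < τ - D := by
      by_contra hn
      have h0 : τ - D = 0 := by linarith
      obtain ⟨z', hz', h'⟩ := key 0 le_rfl one_pos
      have := hmax hz'
      simp only [mem_ofPred_eq] at this
      nlinarith
    have hmD : 0 ≤ Metric.infDist z Y - D := by
      obtain ⟨z', hz', h'⟩ := key 0 le_rfl one_pos
      have := hmax hz'
      simp only [mem_ofPred_eq] at this
      linarith
    set s := (Metric.infDist z Y - D) / (τ - D) with hs
    have hs1 : s < 1 := by rw [hs, div_lt_one hpos]; linarith
    have hs0 : 0 ≤ s := by positivity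
    have hsm : s * (τ - D) = Metric.infDist z Y - D := div_mul_cancel₀ _ hpos.ne'
    obtain ⟨z', hz', h'⟩ := key ((s + 1) / 2) (by linarith) (by linarith)
    have := hmax hz'
    simp only [mem_ofPred_eq] at this
    nlinarith
  have hzp : τ ≤ ‖z - p‖ := by
    rw [← dist_eq_norm]; exact hz.trans (Metric.infDist_le_dist_of_mem hp)
  have hzx' : ‖z - x‖ = τ - D := by rw [← dist_eq_norm, hzx]
  -- Equality holds in the triangle inequality for `z`, `x`, `p`, so by strict convexity the three
  -- points are aligned and `z` is the centre of the enlarged ball.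
  have hz_eq : z - p = τ • (D⁻¹ • (x - p)) := by
    have hsum : z - p = (z - x) + (x - p) := by abel
    have h1 : ‖(z - x) + (x - p)‖ = ‖z - x‖ + ‖x - p‖ := by
      apply le_antisymm (norm_add_le _ _)
      rw [← hsum, hzx', hnD]; linarith
    have h2 := (sameRay_iff_norm_add.2 h1).norm_smul_eq
    rw [hzx', hnD] at h2
    have h3 : z - x = (D⁻¹ * (τ - D)) • (x - p) := by
      rw [mul_smul, h2, smul_smul, inv_mul_cancel₀ hx.ne', one_smul]
    rw [hsum, h3, smul_smul]
    nth_rewrite 2 [← one_smul ℝ (x - p)]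
    rw [← add_smul]
    congr 1
    field_simp
    ring
  refine ⟨hn1, fun y hy => ?_⟩
  have h1 : τ ≤ ‖z - y‖ := by
    rw [← dist_eq_norm]; exact hz.trans (Metric.infDist_le_dist_of_mem hy)
  have h2 : ‖z - y‖ ^ 2 = τ ^ 2 - 2 * τ * inner ℝ (D⁻¹ • (x - p)) (y - p) + ‖y - p‖ ^ 2 := by
    rw [show z - y = (z - p) - (y - p) by abel, norm_sub_sq_real, hz_eq, real_inner_smul_left,
      norm_smul, hn1, Real.norm_eq_abs, mul_one, sq_abs]
    ring
  have h3 : τ ^ 2 ≤ ‖z - y‖ ^ 2 := by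
    apply pow_le_pow_left₀ (by linarith) h1
  linarith

theorem isCompact_proxNormal (Y : Set E) (τ : ℝ) (p : E) : IsCompact (proxNormal Y τ p) := by
  refine (isCompact_sphere (0 : E) 1).of_isClosed_subset ?_ fun n hn => by simpa using hn.1
  refine isClosed_of_closure_subset fun n hn => ?_
  obtain ⟨u, hu, hun⟩ := mem_closure_iff_seq_limit.1 hn
  exact mem_proxNormal_of_tendsto tendsto_const_nhds hun (Eventually.of_forall hu)

/-- The distance grows linearly up to a level `β` along a segment whose direction is uniformly
transverse to the level sets of the distance function. -/
theorem infDist_add_smul_ge_min {A : Set E} (hA : IsClosed A) (hne : A.Nonempty) {z w : E}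
    {α' α β T : ℝ} (hβ : 0 < β) (hα' : 0 ≤ α') (hα : α' < α)
    (hz : 0 < Metric.infDist z A)
    (H : ∀ t, 0 ≤ t → t ≤ T → 0 < Metric.infDist (z + t • w) A →
      Metric.infDist (z + t • w) A ≤ β → ∀ p ∈ A,
      dist (z + t • w) p = Metric.infDist (z + t • w) A →
      α * Metric.infDist (z + t • w) A ≤ inner ℝ w (z + t • w - p)) :
    ∀ t ∈ Icc 0 T, min (Metric.infDist z A + α' * t) β ≤ Metric.infDist (z + t • w) A := by
  set S : Set ℝ := {t | min (Metric.infDist z A + α' * t) β ≤ Metric.infDist (z + t • w) A}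
  have hS : IsClosed S := isClosed_le (by fun_prop)
    ((Metric.continuous_infDist_pt A).comp (by fun_prop))
  -- Continuous induction on `t`: up to level `β` the local growth lemma extends the bound, and
  -- strictly above `β` continuity does.
  refine (hS.inter isClosed_Icc).Icc_subset_of_forall_exists_gt (by simp [S]) ?_
  rintro t ⟨ht, ht0, htT⟩ y hy
  have hmin : 0 < min (Metric.infDist z A + α' * t) β :=
    lt_min (by have := mul_nonneg hα' ht0; linarith) hβ
  have hpos : 0 < Metric.infDist (z + t • w) A := lt_of_lt_of_le hmin ht
  rcases le_or_gt (Metric.infDist (z + t • w) A) β with hle | hgt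
  · obtain ⟨ε, hε, hg⟩ := infDist_add_smul_ge hA hne hpos hα (H t ht0 htT.le hpos hle)
    have hm : 0 < min ε (y - t) := lt_min hε (by simpa using hy)
    refine ⟨t + min ε (y - t), ?_, by linarith, by linarith [min_le_right ε (y - t)]⟩
    have h1 := hg _ hm.le (min_le_left _ _)
    rw [add_assoc, ← add_smul] at h1
    have h2 := mul_nonneg hα' hm.le
    refine le_trans ?_ h1
    rcases min_le_iff.1 (show min (Metric.infDist z A + α' * t) β ≤ _ from ht) with h | h
    · exact (min_le_left _ _).trans (by linarith)
    · exact (min_le_right _ _).trans (by linarith)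
  · have hc : ContinuousAt (fun s : ℝ => Metric.infDist (z + s • w) A) t :=
      ((Metric.continuous_infDist_pt A).comp (by fun_prop)).continuousAt
    have h1 : ∀ᶠ s in 𝓝[>] t, β < Metric.infDist (z + s • w) A :=
      (hc.eventually (lt_mem_nhds hgt)).filter_mono nhdsWithin_le_nhds
    obtain ⟨s, hs, hs'⟩ := (h1.and (Ioc_mem_nhdsGT hy)).exists
    exact ⟨s, (min_le_right _ _).trans hs.le, hs'⟩

end DistanceFunction

/-! ### Balls tangent to the complement and positive independence of normals -/

section TangentBalls

variable {E : Type*} [NormedAddCommGroup E] [InnerProductSpace ℝ E]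

/-- The square root lies below its tangent line: `‖v‖ ≤ (‖v‖ ^ 2 + a ^ 2) / (2 * a)`, which is `(‖v‖
- a) ^ 2 ≥ 0`. -/
theorem norm_smul_add_le {n h : E} {a : ℝ} (ha : 0 < a) (hn : ‖n‖ = 1) :
    ‖a • n + h‖ ≤ a + inner ℝ n h + ‖h‖ ^ 2 / (2 * a) := by
  have h1 : ‖a • n + h‖ ^ 2 = a ^ 2 + 2 * a * inner ℝ n h + ‖h‖ ^ 2 := by
    rw [norm_add_sq_real, norm_smul, hn, real_inner_smul_left, Real.norm_of_nonneg ha.le]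
    ring
  have h2 : a + inner ℝ n h + ‖h‖ ^ 2 / (2 * a) = (‖a • n + h‖ ^ 2 + a ^ 2) / (2 * a) := by
    rw [h1]; field_simp; ring
  rw [h2, le_div_iff₀ (by positivity)]
  nlinarith [sq_nonneg (‖a • n + h‖ - a)]

theorem closedBall_subset_of_mem_proxNormal {X : Set E} (hX : IsClosed X) {τ : ℝ} (hτ : 0 < τ)
    {p n : E} (hn : n ∈ proxNormal (closure Xᶜ) τ p) :
    Metric.closedBall (p + τ • n) τ ⊆ X := by
  rw [← closure_ball _ hτ.ne']
  refine closure_minimal (fun y hy => ?_) hX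
  by_contra hyX
  have h1 := hn.2 y (subset_closure hyX)
  have h2 : ‖y - (p + τ • n)‖ ^ 2 = τ ^ 2 - 2 * τ * inner ℝ n (y - p) + ‖y - p‖ ^ 2 := by
    rw [show y - (p + τ • n) = (y - p) - τ • n by abel, norm_sub_sq_real, norm_smul, hn.1,
      real_inner_smul_right, Real.norm_of_nonneg hτ.le, real_inner_comm]
    ring
  rw [Metric.mem_ball, dist_eq_norm] at hy
  nlinarith [norm_nonneg (y - (p + τ • n))]

/-- Next to a tangent ball contained in `X`, the distance to `X` is quadratically small. -/
theorem infDist_le_sq_of_closedBall_subset {X : Set E} {τ : ℝ} (hτ : 0 < τ) {p n z : E}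
    (hn : ‖n‖ = 1) (hB : Metric.closedBall (p + τ • n) τ ⊆ X) (hz : 0 ≤ inner ℝ n (z - p)) :
    Metric.infDist z X ≤ ‖z - p‖ ^ 2 / (2 * τ) := by
  by_cases hzX : z ∈ X
  · rw [Metric.infDist_zero_of_mem hzX]; positivity
  set c := p + τ • n with hc
  have he : τ < ‖z - c‖ := by
    by_contra h
    exact hzX (hB (by rw [Metric.mem_closedBall, dist_eq_norm]; exact not_lt.1 h))
  have hepos : 0 < ‖z - c‖ := hτ.trans he
  have h1 : ‖z - c‖ ≤ τ + ‖z - p‖ ^ 2 / (2 * τ) := by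
    have h2 := norm_smul_add_le (h := -(z - p)) hτ hn
    rw [inner_neg_right, norm_neg] at h2
    rw [norm_sub_rev, show c - z = τ • n + -(z - p) by rw [hc]; abel]
    linarith
  have h3 : c + (τ / ‖z - c‖) • (z - c) ∈ X := hB <| by
    rw [Metric.mem_closedBall, dist_self_add_left, norm_smul, Real.norm_of_nonneg (by positivity),
      div_mul_cancel₀ _ hepos.ne']
  have h4 := Metric.infDist_le_dist_of_mem (x := z) h3
  have h5 : dist z (c + (τ / ‖z - c‖) • (z - c)) = ‖z - c‖ - τ := by
    rw [dist_eq_norm, show z - (c + (τ / ‖z - c‖) • (z - c))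
      = (1 - τ / ‖z - c‖) • (z - c) by rw [sub_smul, one_smul]; abel, norm_smul,
      Real.norm_of_nonneg (by rw [sub_nonneg, div_le_one hepos]; exact he.le)]
    field_simp
  linarith

theorem exists_inner_nonneg_of_zero_mem_convexHull {P : Set E} (h0 : (0 : E) ∈ convexHull ℝ P)
    (h : E) : ∃ n ∈ P, 0 ≤ inner ℝ n h := by
  by_contra! hcon
  have hconv : Convex ℝ {n : E | inner ℝ n h < 0} := by
    simp_rw [real_inner_comm h]
    exact convex_halfSpace_lt (f := fun n => inner ℝ h n) (innerₛₗ ℝ h).isLinear 0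
  have h1 : inner ℝ (0 : E) h < 0 := convexHull_min (s := P) (fun n hn => hcon n hn) hconv h0
  simp at h1

/-- At a boundary point of a set `X` whose distance function has slope bounded below near `X`,
the proximal normals to the complement are positively independent. -/
theorem zero_notMem_convexHull_proxNormal [ProperSpace E] {X : Set E} (hX : IsClosed X)
    {s μ τ : ℝ} (hs : 0 < s) (hμ : 0 < μ) (hτ : 0 < τ)
    (H : ∀ z, 0 < Metric.infDist z X → Metric.infDist z X ≤ s → ∃ w : E, ‖w‖ = 1 ∧
      ∀ p ∈ X, dist z p = Metric.infDist z X → μ * Metric.infDist z X ≤ inner ℝ w (z - p))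
    {x : E} (hx : x ∈ X) (hxY : x ∈ closure Xᶜ) :
    (0 : E) ∉ convexHull ℝ (proxNormal (closure Xᶜ) τ x) := by
  intro h0
  have hne : X.Nonempty := ⟨x, hx⟩
  -- If `0` is in the hull, every direction from `x` has a nonnegative inner product with some
  -- normal, so the tangent-ball estimate applies on all sides.
  have hquad : ∀ z, Metric.infDist z X ≤ ‖z - x‖ ^ 2 / (2 * τ) := fun z => by
    obtain ⟨n, hn, hnz⟩ := exists_inner_nonneg_of_zero_mem_convexHull h0 (z - x)
    exact infDist_le_sq_of_closedBall_subset hτ hn.1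
      (closedBall_subset_of_mem_proxNormal hX hτ hn) hnz
  -- Climbing from a point off `X` gains at least `μ / 2 * h` while staying within `2 * h ≤ s` of
  -- `x`; the quadratic bound there is `2 * h ^ 2 / τ ≤ μ * h / 4`, a contradiction.
  set h := min (μ * τ / 8) (s / 2) with hh
  have hpos : 0 < h := lt_min (by positivity) (by positivity)
  obtain ⟨y, hy, hxy⟩ := Metric.mem_closure_iff.1 hxY h hpos
  have hy0 : 0 < Metric.infDist y X := (hX.notMem_iff_infDist_pos hne).1 hy
  obtain ⟨z, hz, hzd⟩ := exists_dist_eq_infDist_ge hX hne hpos.le hy0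
    (show 0 ≤ μ / 2 by positivity) (half_lt_self hμ) fun z hz hz0 => H z hz0 <| by
      have h1 := Metric.infDist_le_dist_of_mem (x := z) hx
      have h2 := dist_triangle z y x
      rw [dist_comm y x] at h2
      linarith [min_le_right (μ * τ / 8) (s / 2)]
  have h1 : ‖z - x‖ ≤ 2 * h := by
    rw [← dist_eq_norm]
    have h2 := dist_triangle z y x
    rw [dist_comm y x] at h2
    linarith
  have h2 := hquad z
  rw [le_div_iff₀ (by positivity)] at h2
  have h3 : ‖z - x‖ ^ 2 ≤ (2 * h) ^ 2 := pow_le_pow_left₀ (norm_nonneg _) h1 2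
  have h4 : h ≤ μ * τ / 8 := min_le_left _ _
  have h5 : μ / 2 * h * (2 * τ) < Metric.infDist z X * (2 * τ) :=
    mul_lt_mul_of_pos_right (by linarith) (by positivity)
  nlinarith

end TangentBalls

/-! ### From Clarke gradients, reach and tangent cones to metric statements -/

section Clarke

/-- The distance to `A` is differentiable inside the segments joining a point to a closest point. -/
theorem hasGradientAt_infDist {E : Type*} [NormedAddCommGroup E] [InnerProductSpace ℝ E]
    [CompleteSpace E] {A : Set E} {n p : E} (hp : p ∈ A) (hn : ‖n‖ = 1)
    {a b : ℝ} (ha : 0 < a) (hb : 0 < b) (hd : Metric.infDist (p + (a + b) • n) A = a + b) :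
    HasGradientAt (fun y => Metric.infDist y A) n (p + a • n) := by
  -- The distance is squeezed between two functions with gradient `n`: above by the distance to `p`,
  -- below through the 1-Lipschitz bound from the farther point `p + (a + b) • n`.
  have hup : ∀ h : E, Metric.infDist (p + a • n + h) A ≤
      a + inner ℝ n h + ‖h‖ ^ 2 / (2 * a) := fun h => by
    refine (Metric.infDist_le_dist_of_mem hp).trans ?_
    rw [dist_eq_norm, show p + a • n + h - p = a • n + h by abel]
    exact norm_smul_add_le ha hn
  have hlow : ∀ h : E, a + inner ℝ n h - ‖h‖ ^ 2 / (2 * b) ≤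
      Metric.infDist (p + a • n + h) A := fun h => by
    have h1 : Metric.infDist (p + (a + b) • n) A ≤
        Metric.infDist (p + a • n + h) A + dist (p + (a + b) • n) (p + a • n + h) :=
      Metric.infDist_le_infDist_add_dist
    rw [hd, dist_eq_norm, show p + (a + b) • n - (p + a • n + h) = b • n + -h by
      rw [add_smul]; abel] at h1
    have h2 := norm_smul_add_le (h := -h) hb hn
    rw [inner_neg_right, norm_neg] at h2
    linarith
  have h0 : Metric.infDist (p + a • n) A = a := by
    have h1 := hup 0
    have h2 := hlow 0
    simp at h1 h2
    linarith
  have hO : (fun y => (Metric.infDist y A - inner ℝ n y) -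
      (Metric.infDist (p + a • n) A - inner ℝ n (p + a • n))) =O[𝓝 (p + a • n)]
        fun y => ‖y - (p + a • n)‖ ^ 2 := by
    refine Asymptotics.IsBigO.of_bound (1 / (2 * a) + 1 / (2 * b)) (Eventually.of_forall fun y => ?_)
    have h1 := hup (y - (p + a • n))
    have h2 := hlow (y - (p + a • n))
    rw [add_sub_cancel, inner_sub_right] at h1 h2
    rw [h0, Real.norm_eq_abs, Real.norm_of_nonneg (by positivity)]
    have h3 : 0 ≤ ‖y - (p + a • n)‖ ^ 2 / (2 * a) := by positivity
    have h4 : 0 ≤ ‖y - (p + a • n)‖ ^ 2 / (2 * b) := by positivity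
    rw [show (1 / (2 * a) + 1 / (2 * b)) * ‖y - (p + a • n)‖ ^ 2 =
      ‖y - (p + a • n)‖ ^ 2 / (2 * a) + ‖y - (p + a • n)‖ ^ 2 / (2 * b) by ring, abs_le]
    constructor <;> linarith
  have h1 : HasFDerivAt (fun y => Metric.infDist y A - inner ℝ n y) (0 : E →L[ℝ] ℝ)
      (p + a • n) :=
    (hasFDerivAt_sub_const_iff _).1 (hO.hasFDerivAt one_lt_two)
  have h2 := h1.add (innerSL ℝ n).hasFDerivAt
  rw [hasGradientAt_iff_hasFDerivAt]
  have h3 : (fun y => Metric.infDist y A - inner ℝ n y) + innerSL ℝ n =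
      fun y => Metric.infDist y A := by ext y; simp
  rw [h3, zero_add] at h2
  exact h2

variable {d : ℕ}

/-- Strictly between `p` and `z` the distance is differentiable with the constant gradient `n`;
letting the points tend to `z` gives `n` as a limit of gradients. -/
theorem smul_sub_mem_clarke {A : Set (EuclideanSpace ℝ (Fin d))}
    {z p : EuclideanSpace ℝ (Fin d)} (hp : p ∈ A)
    (hz : 0 < Metric.infDist z A) (hzp : dist z p = Metric.infDist z A) :
    (Metric.infDist z A)⁻¹ • (z - p) ∈ clarke (fun y => Metric.infDist y A) z := by
  set D := Metric.infDist z A with hD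
  set n := D⁻¹ • (z - p) with hn
  have hDn : D • n = z - p := by rw [hn, smul_smul, mul_inv_cancel₀ hz.ne', one_smul]
  have hn1 : ‖n‖ = 1 := by
    rw [hn, norm_smul, ← dist_eq_norm, hzp, norm_inv, Real.norm_of_nonneg hz.le,
      inv_mul_cancel₀ hz.ne']
  have hgrad : ∀ k : ℕ, HasGradientAt (fun y => Metric.infDist y A) n
      (p + (D - D / (k + 2)) • n) := fun k => by
    have h2 : (0 : ℝ) < k + 2 := by positivity
    refine hasGradientAt_infDist hp hn1 (b := D / (k + 2)) ?_ (by positivity) ?_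
    · rw [sub_pos, div_lt_iff₀ h2]; nlinarith
    · rw [sub_add_cancel, hDn, add_sub_cancel]
  refine subset_convexHull ℝ _ ⟨fun k : ℕ => p + (D - D / (k + 2)) • n, ?_,
    fun k => (hgrad k).differentiableAt, ?_⟩
  · have h1 : Tendsto (fun k : ℕ => D / ((k : ℝ) + 2)) atTop (𝓝 0) :=
      tendsto_const_nhds.div_atTop (tendsto_atTop_add_const_right _ _ tendsto_natCast_atTop_atTop)
    have h2 := tendsto_const_nhds (x := p) |>.add
      ((tendsto_const_nhds (x := D).sub h1).smul_const n)
    rwa [sub_zero, hDn, add_sub_cancel] at h2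
  · simp_rw [fun k => (hgrad k).gradient]
    exact tendsto_const_nhds

/-- If the Clarke gradient of the distance to `A` is far from zero, the directions from the closest
points lie in a common half-space. -/
theorem exists_unit_inner_ge_of_le_minNorm {A : Set (EuclideanSpace ℝ (Fin d))} (hA : IsClosed A)
    (hne : A.Nonempty) {μ : ℝ} (hμ : 0 < μ) {z : EuclideanSpace ℝ (Fin d)}
    (hz : 0 < Metric.infDist z A) (h : μ ≤ minNorm (clarke (fun y => Metric.infDist y A) z)) :
    ∃ w : EuclideanSpace ℝ (Fin d), ‖w‖ = 1 ∧ ∀ p ∈ A, dist z p = Metric.infDist z A →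
      μ * Metric.infDist z A ≤ inner ℝ w (z - p) := by
  -- Passing to the closure preserves the minimal norm and makes it attained at some `v`; the
  -- variational inequality of the projection of `0` then yields the half-space with direction `v /
  -- ‖v‖`.
  set C := closure (clarke (fun y => Metric.infDist y A) z) with hC
  obtain ⟨p₀, hp₀, hzp₀⟩ := hA.exists_infDist_eq_dist hne z
  have hCne : C.Nonempty := ⟨_, subset_closure (smul_sub_mem_clarke hp₀ hz hzp₀.symm)⟩
  have hCconv : Convex ℝ C := (convex_convexHull ℝ _).closure
  obtain ⟨v, hv, hvmin⟩ := exists_norm_eq_iInf_of_complete_convex hCne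
    isClosed_closure.isComplete hCconv 0
  have hvar := (norm_eq_iInf_iff_real_inner_le_zero hCconv hv).1 hvmin
  have hμv : μ ≤ ‖v‖ := by
    rw [minNorm, ← Metric.infDist_closure] at h
    refine h.trans ((Metric.infDist_le_dist_of_mem hv).trans ?_)
    rw [dist_zero_left]
  have hvpos : 0 < ‖v‖ := hμ.trans_le hμv
  refine ⟨‖v‖⁻¹ • v, by rw [norm_smul, norm_inv, norm_norm, inv_mul_cancel₀ hvpos.ne'],
    fun p hp hzp => ?_⟩
  have h1 := hvar _ (subset_closure (smul_sub_mem_clarke hp hz hzp))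
  rw [zero_sub, inner_neg_left, inner_sub_right, real_inner_self_eq_norm_sq,
    real_inner_smul_right] at h1
  have h2 : ‖v‖ ^ 2 ≤ (Metric.infDist z A)⁻¹ * inner ℝ v (z - p) := by linarith
  rw [inv_mul_eq_div, le_div_iff₀ hz] at h2
  rw [real_inner_smul_left, inv_mul_eq_div, le_div_iff₀ hvpos]
  nlinarith [mul_le_mul_of_nonneg_right hμv (mul_pos hz hvpos).le]

theorem exists_real_of_muReach_pos {μ : ℝ} {X : Set (EuclideanSpace ℝ (Fin d))} (hne : X.Nonempty)
    (h : 0 < muReach μ X) : ∃ s : ℝ, 0 < s ∧ ∀ x, 0 < Metric.infDist x X →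
      Metric.infDist x X ≤ s → μ ≤ minNorm (clarke (fun y => Metric.infDist y X) x) := by
  obtain ⟨s, hs, hs0⟩ := lt_sSup_iff.1 h
  obtain ⟨s', hs'0, hs'⟩ := ENNReal.lt_iff_exists_real_btwn.1 hs0
  refine ⟨s', ENNReal.ofReal_pos.1 hs'.1, fun x hx hxs => hs x ?_ ?_⟩
  · exact (ENNReal.toReal_pos_iff.1 hx).1
  · rw [← ENNReal.ofReal_toReal (Metric.infEDist_ne_top hne)]
    exact (ENNReal.ofReal_le_ofReal hxs).trans hs'.2.le

theorem exists_real_of_reach_pos {A : Set (EuclideanSpace ℝ (Fin d))} (hne : A.Nonempty)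
    (h : 0 < reach A) : ∃ R : ℝ, 0 < R ∧ ∀ x, Metric.infDist x A < R →
      ∃! a, a ∈ A ∧ dist x a = Metric.infDist x A := by
  obtain ⟨s, hs, hs0⟩ := lt_sSup_iff.1 h
  obtain ⟨s', hs'0, hs'⟩ := ENNReal.lt_iff_exists_real_btwn.1 hs0
  refine ⟨s', ENNReal.ofReal_pos.1 hs'.1, fun x hx => hs x ?_⟩
  rw [← ENNReal.ofReal_toReal (Metric.infEDist_ne_top hne)]
  exact (ENNReal.ofReal_le_ofReal hx.le).trans_lt hs'.2

/-- Proximal normals belong to the polar of the tangent cone. -/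
theorem proxNormal_subset_tangentPolar {Y : Set (EuclideanSpace ℝ (Fin d))} {τ : ℝ} (hτ : 0 < τ)
    (p : EuclideanSpace ℝ (Fin d)) : proxNormal Y τ p ⊆ tangentPolar Y p := by
  intro n hn b hb
  -- This function vanishes at `p` with gradient `2 * τ * n`, so the first-order condition on
  -- tangent vectors is the polarity of `n`.
  have hmax : IsLocalMaxOn (fun y => 2 * τ * inner ℝ n (y - p) - ‖y - p‖ ^ 2) Y p := by
    refine eventually_nhdsWithin_of_forall fun y hy => ?_
    have := hn.2 y hy
    simpa using this
  have h1 : HasFDerivAt (fun y : EuclideanSpace ℝ (Fin d) => y - p)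
      (ContinuousLinearMap.id ℝ _) p := (hasFDerivAt_id p).sub_const p
  have h2 := (((innerSL ℝ n).hasFDerivAt.comp p h1).const_mul (2 * τ)).sub h1.norm_sq
  have h3 := hmax.hasFDerivWithinAt_nonpos (f' := _) h2.hasFDerivWithinAt hb
  simp at h3
  nlinarith

theorem convex_tangentPolar (A : Set (EuclideanSpace ℝ (Fin d))) (x : EuclideanSpace ℝ (Fin d)) :
    Convex ℝ (tangentPolar A x) := by
  intro u hu v hv a b ha hb _ t ht
  rw [inner_add_left, real_inner_smul_left, real_inner_smul_left]
  have h1 := mul_nonpos_of_nonneg_of_nonpos ha (hu t ht)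
  have h2 := mul_nonpos_of_nonneg_of_nonpos hb (hv t ht)
  linarith

end Clarke

/-! ### Compactness, separation and gluing of transverse directions -/

section TransverseField

theorem tendsto_of_dist_lt_of_tendsto {E : Type*} [PseudoMetricSpace E] {ι : Type*} {l : Filter ι} {x y : ι → E} {ε : ι → ℝ}
    (hε : Tendsto ε l (𝓝 0)) (h : ∀ i, dist (x i) (y i) < ε i) {a : E} (hy : Tendsto y l (𝓝 a)) :
    Tendsto x l (𝓝 a) :=
  tendsto_of_tendsto_of_dist hy <|
    squeeze_zero (fun _ => dist_nonneg) (fun i => dist_comm (x i) (y i) ▸ (h i).le) hε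

/-- Points of `X` with values tending to at most `c` accumulate on the sublevel set. This places the
perturbed sublevel sets in the region where the uniform transversality bounds hold. -/
theorem exists_forall_dist_sublevel_lt {E : Type*} [PseudoMetricSpace E] {X : Set E} (hX : IsCompact X) {f : E → ℝ}
    (hf : Continuous f) (c : ℝ) {δ : ℝ} (hδ : 0 < δ) :
    ∃ ε > 0, ∀ x ∈ X, f x ≤ c + ε → ∃ k ∈ X ∩ f ⁻¹' Iic c, dist x k < δ := by
  by_contra! hcon
  choose x hx hfx hfar using fun i : ℕ => hcon (1 / (i + 1)) (by positivity)
  obtain ⟨x₀, hx₀, φ, hφ, hlim⟩ := hX.tendsto_subseq hx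
  have hε : Tendsto (fun i => 1 / ((φ i : ℝ) + 1)) atTop (𝓝 0) :=
    (tendsto_one_div_add_atTop_nhds_zero_nat (𝕜 := ℝ)).comp hφ.tendsto_atTop
  have hfc : f x₀ ≤ c := by
    have h1 := le_of_tendsto_of_tendsto ((hf.tendsto _).comp hlim) (hε.const_add c)
      (Eventually.of_forall fun i => hfx (φ i))
    rwa [add_zero] at h1
  have h2 := hlim.dist (tendsto_const_nhds (x := x₀))
  rw [dist_self] at h2
  obtain ⟨i, hi⟩ := (h2.eventually (gt_mem_nhds hδ)).exists
  exact absurd (hfar (φ i) x₀ ⟨hx₀, hfc⟩) (not_le.2 hi)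

theorem exists_uniform_inner_gradient {E : Type*} [NormedAddCommGroup E]
    [InnerProductSpace ℝ E] {K : Set E} (hK : IsCompact K) {f : E → ℝ}
    (hf : Continuous f) {g w : E → E} (hg : Continuous g) (hw : Continuous w) {c : ℝ}
    (H : ∀ x ∈ K, f x = c → inner ℝ (w x) (g x) < 0) :
    ∃ δ > 0, ∀ k ∈ K, ∀ x, dist x k < δ → |f x - c| < δ → ∀ z, dist z x < δ →
      inner ℝ (w x) (g z) ≤ -δ := by
  by_contra! hcon
  choose k hk x hx hfx z hz hlt using fun i : ℕ => hcon (1 / (i + 1)) (by positivity)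
  obtain ⟨k₀, hk₀, φ, hφ, hlim⟩ := hK.tendsto_subseq hk
  have hε : Tendsto (fun i => 1 / ((φ i : ℝ) + 1)) atTop (𝓝 0) :=
    (tendsto_one_div_add_atTop_nhds_zero_nat (𝕜 := ℝ)).comp hφ.tendsto_atTop
  have hx' := tendsto_of_dist_lt_of_tendsto hε (fun i => hx (φ i)) hlim
  have hz' := tendsto_of_dist_lt_of_tendsto hε (fun i => hz (φ i)) hx'
  have hfc : f k₀ = c := by
    have h1 : |f k₀ - c| ≤ 0 := le_of_tendsto_of_tendsto
      ((((hf.tendsto _).comp hx').sub_const c).abs) hε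
      (Eventually.of_forall fun i => (hfx (φ i)).le)
    linarith [abs_nonpos_iff.1 h1]
  have hε' := hε.neg
  rw [neg_zero] at hε'
  exact absurd (le_of_tendsto_of_tendsto hε' (((hw.tendsto _).comp hx').inner
    ((hg.tendsto _).comp hz')) (Eventually.of_forall fun i => (hlt (φ i)).le))
    (not_le.2 (H k₀ hk₀ hfc))

variable {E : Type*} [NormedAddCommGroup E] [InnerProductSpace ℝ E] [FiniteDimensional ℝ E]

/-- In finite dimension the convex hull of a compact set is compact. -/
theorem isCompact_convexHull_of_isCompact {Q : Set E} (hQ : IsCompact Q) :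
    IsCompact (convexHull ℝ Q) := by
  rcases Q.eq_empty_or_nonempty with rfl | ⟨q, hq⟩
  · simp
  -- Carathéodory: `m` points suffice, so the hull is the image of a compact set of weights and
  -- points. Shorter combinations are padded with zero weights at `q`.
  set m := Module.finrank ℝ E + 1
  have hK : IsCompact (stdSimplex ℝ (Fin m) ×ˢ univ.pi fun _ : Fin m => Q) :=
    (isCompact_stdSimplex ℝ (Fin m)).prod (isCompact_univ_pi fun _ => hQ)
  convert hK.image (f := fun a : (Fin m → ℝ) × (Fin m → E) => ∑ i, a.1 i • a.2 i) (by fun_prop)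
    using 1
  apply Subset.antisymm
  · intro x hx
    obtain ⟨ι, _, z, a, hz, hai, ha, ha1, hx⟩ := eq_pos_convex_span_of_mem_convexHull hx
    obtain ⟨e⟩ : Nonempty (ι ↪ Fin m) := Function.Embedding.nonempty_of_card_le <| by
      simpa using hai.card_le_finrank_succ.trans
        (Nat.add_le_add_right (Submodule.finrank_le _) 1)
    have hout : ∀ j, j ∉ range e → Function.extend e a 0 j = 0 := fun j hj =>
      Function.extend_apply' _ _ _ (by simpa using hj)
    refine ⟨(Function.extend e a 0, Function.extend e z fun _ => q), ⟨⟨fun j => ?_, ?_⟩,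
      fun j _ => ?_⟩, ?_⟩
    · by_cases hj : j ∈ range e
      · obtain ⟨i, rfl⟩ := hj
        simpa [e.injective.extend_apply] using (ha i).le
      · exact (hout j hj).ge
    · rw [← ha1]
      exact (Fintype.sum_of_injective e e.injective _ _ hout
        fun i => (e.injective.extend_apply _ _ _).symm).symm
    · by_cases hj : j ∈ range e
      · obtain ⟨i, rfl⟩ := hj
        simpa [e.injective.extend_apply] using hz (mem_range_self i)
      · simpa only [Function.extend_apply' _ _ _ (show ¬∃ i, e i = j by simpa using hj)] using hq
    · rw [← hx]
      exact (Fintype.sum_of_injective e e.injective _ _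
        (fun j hj => by simp only [hout j hj, zero_smul])
        fun i => by simp only [e.injective.extend_apply]).symm
  · rintro _ ⟨⟨a, z⟩, ⟨ha, hz⟩, rfl⟩
    exact (convex_convexHull ℝ Q).sum_mem (fun i _ => ha.1 i) ha.2
      fun i _ => subset_convexHull ℝ Q (hz i trivial)

theorem exists_inner_pos_of_zero_notMem_convexHull {Q : Set E} (hQ : IsCompact Q)
    (h0 : (0 : E) ∉ convexHull ℝ Q) : ∃ w : E, ∀ n ∈ Q, 0 < inner ℝ w n := by
  have : CompleteSpace E := FiniteDimensional.complete ℝ E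
  obtain ⟨f, u, hu, hf⟩ := geometric_hahn_banach_point_closed (convex_convexHull ℝ Q)
    (isCompact_convexHull_of_isCompact hQ).isClosed h0
  refine ⟨(InnerProductSpace.toDual ℝ E).symm f, fun n hn => ?_⟩
  rw [InnerProductSpace.toDual_symm_apply]
  rw [map_zero] at hu
  exact hu.trans (hf n (subset_convexHull ℝ Q hn))

/-- It suffices to separate `0` from the hull of `P ∪ {-g}`: a convex combination equal to `0` would
put `0` in the hull of `P` or make `g` a nonnegative multiple of a point of it. -/
theorem exists_inner_pos_inner_neg {P : Set E} (hP : IsCompact P)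
    (h0 : (0 : E) ∉ convexHull ℝ P) {g : E} (hg : g ≠ 0)
    (hgP : ∀ m ∈ convexHull ℝ P, ∀ t : ℝ, 0 ≤ t → g ≠ t • m) :
    ∃ w : E, (∀ n ∈ P, 0 < inner ℝ w n) ∧ inner ℝ w g < 0 := by
  have h1 : (0 : E) ∉ convexHull ℝ (insert (-g) P) := by
    rcases P.eq_empty_or_nonempty with rfl | hne
    · simpa using hg
    · rw [convexHull_insert hne]
      simp only [convexJoin_singleton_left, mem_iUnion, not_exists]
      rintro m hm ⟨a, b, ha, hb, hab, h⟩
      rcases ha.eq_or_lt with rfl | hapos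
      · rw [zero_add] at hab
        rw [hab, zero_smul, zero_add, one_smul] at h
        exact h0 (h ▸ hm)
      · refine hgP m hm (b / a) (by positivity) ?_
        rw [smul_neg, neg_add_eq_zero] at h
        rw [div_eq_inv_mul, mul_smul, ← h, smul_smul, inv_mul_cancel₀ hapos.ne', one_smul]
  obtain ⟨w, hw⟩ := exists_inner_pos_of_zero_notMem_convexHull (hP.insert _) h1
  refine ⟨w, fun n hn => hw n (mem_insert_of_mem _ hn), ?_⟩
  have := hw _ (mem_insert _ _)
  rw [inner_neg_right] at this
  linarith

/-- Transversality to the proximal normals is an open condition on the base point. -/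
theorem eventually_inner_proxNormal_pos {Y : Set E} (hY : IsClosed Y) {τ : ℝ} {x w : E}
    (h : x ∈ Y → ∀ n ∈ proxNormal Y τ x, 0 < inner ℝ w n) :
    ∀ᶠ y in 𝓝 x, y ∈ Y → ∀ n ∈ proxNormal Y τ y, 0 < inner ℝ w n := by
  by_contra hcon
  rw [not_eventually] at hcon
  obtain ⟨u, hu, hux⟩ := exists_seq_forall_of_frequently hcon
  push Not at hux
  choose huY n hn hnw using hux
  obtain ⟨n₀, -, φ, hφ, hlim⟩ := (isCompact_sphere (0 : E) 1).tendsto_subseq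
    (x := n) (fun k => by simpa using (hn k).1)
  have hx := hu.comp hφ.tendsto_atTop
  have h1 := h (hY.mem_of_tendsto hx (Eventually.of_forall fun k => huY _)) n₀
    (mem_proxNormal_of_tendsto hx hlim (Eventually.of_forall fun k => hn _))
  exact absurd (le_of_tendsto (tendsto_const_nhds.inner hlim)
    (Eventually.of_forall fun k => hnw _)) (not_le.2 h1)

/-- Pointwise transverse directions can be glued to a continuous vector field. -/
theorem exists_continuous_transverse {K Y : Set E} (hK : IsClosed K) (hY : IsClosed Y) {τ c : ℝ}
    {f : E → ℝ} (hf : Continuous f) {g : E → E} (hg : Continuous g) (hfc : ∀ x ∈ K, f x ≤ c)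
    (H : ∀ x ∈ K, ∃ w : E, (x ∈ Y → ∀ n ∈ proxNormal Y τ x, 0 < inner ℝ w n) ∧
      (f x = c → inner ℝ w (g x) < 0)) :
    ∃ w : C(E, E), ∀ x ∈ K, (x ∈ Y → ∀ n ∈ proxNormal Y τ x, 0 < inner ℝ (w x) n) ∧
      (f x = c → inner ℝ (w x) (g x) < 0) := by
  refine exists_continuous_forall_mem_convex_of_local_const
    (t := fun x => {w : E | x ∈ K → (x ∈ Y → ∀ n ∈ proxNormal Y τ x, 0 < inner ℝ w n) ∧
      (f x = c → inner ℝ w (g x) < 0)}) (fun x => ?_) fun x => ?_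
  · intro u hu v hv a b ha hb hab hx
    have hpos : ∀ {p q : ℝ}, 0 < p → 0 < q → 0 < a * p + b * q := fun {p q} hp hq => by
      rcases ha.eq_or_lt with rfl | ha'
      · rw [zero_add] at hab; rw [hab]; linarith
      · have := mul_pos ha' hp; have := mul_nonneg hb hq.le; linarith
    refine ⟨fun hxY n hn => ?_, fun hxc => ?_⟩
    · rw [inner_add_left, real_inner_smul_left, real_inner_smul_left]
      exact hpos ((hu hx).1 hxY n hn) ((hv hx).1 hxY n hn)
    · rw [inner_add_left, real_inner_smul_left, real_inner_smul_left]
      have := hpos (neg_pos.2 ((hu hx).2 hxc)) (neg_pos.2 ((hv hx).2 hxc))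
      linarith
  · by_cases hx : x ∈ K
    · obtain ⟨w, hw1, hw2⟩ := H x hx
      refine ⟨w, ?_⟩
      have h1 : ∀ᶠ y in 𝓝 x, f y = c → inner ℝ w (g y) < 0 := by
        rcases (hfc x hx).lt_or_eq with h | h
        · filter_upwards [hf.continuousAt.eventually (gt_mem_nhds h)] with y hy hyc
          exact absurd hyc hy.ne
        · have hc : ContinuousAt (fun y => inner ℝ w (g y)) x := by fun_prop
          filter_upwards [hc.eventually (gt_mem_nhds (hw2 h))] with y hy _ using hy
      filter_upwards [eventually_inner_proxNormal_pos hY hw1, h1] with y h2 h3 _ using ⟨h2, h3⟩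
    · refine ⟨0, ?_⟩
      filter_upwards [hK.isOpen_compl.mem_nhds hx] with y hy hyK
      exact absurd hyK hy

/-- A sequence of violations with `δ → 0` has all its base points converging to one point of `K ∩
Y`, and the closed graph of proximal normals makes a limit normal violate `H`. -/
theorem exists_uniform_inner_proxNormal {K Y : Set E} (hK : IsCompact K) (hY : IsClosed Y) {τ : ℝ}
    {w : E → E} (hw : Continuous w)
    (H : ∀ x ∈ K, x ∈ Y → ∀ n ∈ proxNormal Y τ x, 0 < inner ℝ (w x) n) :
    ∃ δ > 0, ∀ k ∈ K, ∀ x, dist x k < δ → ∀ p ∈ Y, dist p x < δ → ∀ n ∈ proxNormal Y τ p,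
      δ ≤ inner ℝ (w x) n := by
  by_contra! hcon
  choose k hk x hx p hp hpx n hn hlt using fun i : ℕ => hcon (1 / (i + 1)) (by positivity)
  obtain ⟨⟨k₀, n₀⟩, hmem, φ, hφ, hlim⟩ := (hK.prod (isCompact_sphere (0 : E) 1)).tendsto_subseq
    (x := fun i => (k i, n i)) (fun i => ⟨hk i, by simpa using (hn i).1⟩)
  have hε : Tendsto (fun i => 1 / ((φ i : ℝ) + 1)) atTop (𝓝 0) :=
    (tendsto_one_div_add_atTop_nhds_zero_nat (𝕜 := ℝ)).comp hφ.tendsto_atTop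
  have hk' : Tendsto (fun i => k (φ i)) atTop (𝓝 k₀) := (continuous_fst.tendsto _).comp hlim
  have hn' : Tendsto (fun i => n (φ i)) atTop (𝓝 n₀) := (continuous_snd.tendsto _).comp hlim
  have hx' := tendsto_of_dist_lt_of_tendsto hε (fun i => hx (φ i)) hk'
  have hp' := tendsto_of_dist_lt_of_tendsto hε (fun i => hpx (φ i)) hx'
  have h1 := H k₀ hmem.1 (hY.mem_of_tendsto hp' (Eventually.of_forall fun i => hp _)) n₀
    (mem_proxNormal_of_tendsto hp' hn' (Eventually.of_forall fun i => hn _))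
  exact absurd (le_of_tendsto_of_tendsto (((hw.tendsto _).comp hx').inner hn') hε
    (Eventually.of_forall fun i => (hlt (φ i)).le)) (not_le.2 h1)

end TransverseField

/-! ### Homotopy equivalence from straight displacements -/

section Homotopy

variable {E : Type*} [NormedAddCommGroup E] [NormedSpace ℝ E]

/-- Displacements along a vector field that preserve `A` and `B` up to time `T` and exchange them at
time `T` give a homotopy equivalence. -/
theorem nonempty_homotopyEquiv_of_displacement {w : E → E} (hw : Continuous w) {T : ℝ} (hT : 0 ≤ T)
    {A B : Set E} (hA : ∀ x ∈ A, ∀ t ∈ Icc 0 T, x + t • w x ∈ A) (hAB : ∀ x ∈ A, x + T • w x ∈ B)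
    (hB : ∀ x ∈ B, ∀ t ∈ Icc 0 T, x + t • w x ∈ B) (hBA : ∀ x ∈ B, x + T • w x ∈ A) :
    Nonempty (ContinuousMap.HomotopyEquiv A B) := by
  have key : ∀ {C D : Set E} (hC : ∀ x ∈ C, ∀ t ∈ Icc 0 T, x + t • w x ∈ C)
      (hCD : ∀ x ∈ C, x + T • w x ∈ D) (hDC : ∀ x ∈ D, x + T • w x ∈ C),
      (ContinuousMap.comp ⟨fun x : D => (⟨x.1 + T • w x.1, hDC _ x.2⟩ : C), by fun_prop⟩
        ⟨fun x : C => (⟨x.1 + T • w x.1, hCD _ x.2⟩ : D), by fun_prop⟩).Homotopic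
        (ContinuousMap.id C) := by
    intro C D hC hCD hDC
    have hmem : ∀ s : unitInterval, (s : ℝ) * T ∈ Icc 0 T := fun s =>
      ⟨mul_nonneg s.2.1 hT, mul_le_of_le_one_left hT s.2.2⟩
    -- The composite is the time-`T` displacement applied twice; scaling both times by `s` deforms
    -- the identity into it inside `C`.
    refine ContinuousMap.Homotopic.symm ⟨⟨⟨fun q : unitInterval × C =>
      (⟨(q.2.1 + ((q.1 : ℝ) * T) • w q.2.1) +
        ((q.1 : ℝ) * T) • w (q.2.1 + ((q.1 : ℝ) * T) • w q.2.1),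
        hC _ (hC _ q.2.2 _ (hmem q.1)) _ (hmem q.1)⟩ : C), by fun_prop⟩, fun x => ?_, fun x => ?_⟩⟩
    · ext1; simp
    · ext1; simp
  exact ⟨⟨_, _, key hA hAB hBA, key hB hBA hAB⟩⟩

end Homotopy

/-! ### Effect of displacements on functions and on the distance to the complement -/

section Displacement

theorem exists_lipschitz_bound_closedBall {E F : Type*} [NormedAddCommGroup E] [NormedSpace ℝ E]
    [ProperSpace E] [NormedAddCommGroup F] [NormedSpace ℝ F] {g : E → F} (hg : ContDiff ℝ 1 g)
    (ρ : ℝ) : ∃ L > 0, (∀ x ∈ Metric.closedBall (0 : E) ρ, ‖fderiv ℝ g x‖ ≤ L) ∧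
      ∀ x ∈ Metric.closedBall (0 : E) ρ, ∀ y ∈ Metric.closedBall (0 : E) ρ,
        ‖g y - g x‖ ≤ L * ‖y - x‖ := by
  obtain ⟨L, hL⟩ := (isCompact_closedBall (0 : E) ρ).exists_bound_of_continuousOn
    (hg.continuous_fderiv one_ne_zero).continuousOn
  have hL' : ∀ x ∈ Metric.closedBall (0 : E) ρ, ‖fderiv ℝ g x‖ ≤ max L 1 :=
    fun x hx => (hL x hx).trans (le_max_left _ _)
  exact ⟨max L 1, by positivity, hL', fun x hx y hy =>
    (convex_closedBall _ _).norm_image_sub_le_of_norm_fderiv_le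
      (fun z _ => (hg.differentiable one_ne_zero).differentiableAt) hL' hx hy⟩

variable {E : Type*} [NormedAddCommGroup E] [InnerProductSpace ℝ E]

theorem inner_gradient_eq_fderiv [CompleteSpace E] (f : E → ℝ) (x w : E) :
    inner ℝ w (gradient f x) = fderiv ℝ f x w := by
  rw [real_inner_comm, gradient, InnerProductSpace.toDual_symm_apply]

theorem continuous_gradient [CompleteSpace E] {f : E → ℝ} (hf : ContDiff ℝ 1 f) :
    Continuous (gradient f) :=
  (InnerProductSpace.toDual ℝ E).symm.continuous.comp (hf.continuous_fderiv one_ne_zero)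

/-- A function decreases along displacements close to a direction of descent. -/
theorem le_sub_of_inner_gradient_le [CompleteSpace E] {f : E → ℝ} (hf : Differentiable ℝ f)
    {x w e z₀ z₁ : E} {δ L t : ℝ} (hw : ∀ z, dist z x < δ → inner ℝ w (gradient f z) ≤ -δ)
    (hL : ∀ z, dist z x < δ → ‖fderiv ℝ f z‖ ≤ L) (h₀ : dist z₀ x < δ) (h₁ : dist z₁ x < δ)
    (ht : 0 ≤ t) (he : z₁ - z₀ = t • w + e) : f z₁ ≤ f z₀ - δ * t + L * ‖e‖ := by
  obtain ⟨ξ, hξ, hmvt⟩ := domain_mvt (s := Metric.ball x δ) (f := f) (f' := fderiv ℝ f)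
    (fun z _ => (hf z).hasFDerivAt.hasFDerivWithinAt) (convex_ball x δ) h₀ h₁
  have hξx : dist ξ x < δ := (convex_ball x δ).segment_subset h₀ h₁ hξ
  rw [he, map_add, map_smul, smul_eq_mul] at hmvt
  have h2 := hw ξ hξx
  rw [inner_gradient_eq_fderiv] at h2
  have h3 := (le_abs_self _).trans ((fderiv ℝ f ξ).le_of_opNorm_le (hL ξ hξx) e)
  have h4 := mul_le_mul_of_nonneg_left h2 ht
  linarith

/-- Displacements of a point of `X` in a direction transverse to the proximal normals of the
complement move away from the complement at a linear rate. -/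
theorem infDist_compl_add_smul_ge [ProperSpace E] {X : Set E} (hXint : closure (interior X) = X)
    (hne : (closure Xᶜ).Nonempty) {R τ δ T : ℝ}
    (hR : ∀ x, Metric.infDist x (closure Xᶜ) < R →
      ∃! a, a ∈ closure Xᶜ ∧ dist x a = Metric.infDist x (closure Xᶜ))
    (hτ : 0 < τ) (hτR : τ < R) (hδ : 0 < δ) {x w : E} (hx : x ∈ X)
    (hw : ∀ p ∈ closure Xᶜ, dist p x < δ → ∀ n ∈ proxNormal (closure Xᶜ) τ p, δ ≤ inner ℝ w n)
    (hT : T * ‖w‖ ≤ δ / 4) : ∀ t ∈ Icc 0 T,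
      min (Metric.infDist x (closure Xᶜ) + δ / 2 * t) (min (δ / 4) τ) ≤
        Metric.infDist (x + t • w) (closure Xᶜ) := by
  intro t ht
  set Y := closure Xᶜ with hY
  have hYc : IsClosed Y := isClosed_closure
  -- The growth lemma needs a positive initial distance, so it is used at interior points with the
  -- fixed vector `w`; density of the interior then reaches `x`. Closest points `p` stay within `δ`
  -- of `x`: at most `δ / 4` each from the level, the displacement and `dist z x`.
  have hnear : ∀ z ∈ interior X, dist z x < δ / 4 →
      min (Metric.infDist z Y + δ / 2 * t) (min (δ / 4) τ) ≤ Metric.infDist (z + t • w) Y := by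
    intro z hz hzx
    have hz0 : 0 < Metric.infDist z Y := by
      refine (hYc.notMem_iff_infDist_pos hne).1 ?_
      rwa [interior_eq_compl_closure_compl] at hz
    refine infDist_add_smul_ge_min hYc hne (by positivity) (by positivity) (half_lt_self hδ)
      hz0 (fun s hs hsT hpos hle p hp hpd => ?_) t ht
    have hn := mem_proxNormal_of_unique hYc hR hτR hpos (hle.trans (min_le_right _ _)) hp hpd
    have hpx : dist p x < δ := by
      have h1 := dist_triangle4 p (z + s • w) z x
      have h2 : dist (z + s • w) z = s * ‖w‖ := by
        rw [dist_self_add_left, norm_smul, Real.norm_of_nonneg hs]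
      have h3 := mul_le_mul_of_nonneg_right hsT (norm_nonneg w)
      rw [dist_comm p (z + s • w), hpd, h2] at h1
      have := hle.trans (min_le_left _ _)
      linarith
    have h4 := hw p hp hpx _ hn
    rwa [real_inner_smul_right, inv_mul_eq_div, le_div_iff₀ hpos] at h4
  have hx' : x ∈ closure (interior X) := hXint.symm ▸ hx
  obtain ⟨u, hu, hux⟩ := mem_closure_iff_seq_limit.1 hx'
  have hc := Metric.continuous_infDist_pt Y
  have hlim1 : Tendsto (fun k => min (Metric.infDist (u k) Y + δ / 2 * t) (min (δ / 4) τ)) atTop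
      (𝓝 (min (Metric.infDist x Y + δ / 2 * t) (min (δ / 4) τ))) :=
    (((hc.tendsto x).comp hux).add_const _).min tendsto_const_nhds
  have hlim2 : Tendsto (fun k => Metric.infDist (u k + t • w) Y) atTop
      (𝓝 (Metric.infDist (x + t • w) Y)) := (hc.tendsto _).comp (hux.add_const _)
  refine le_of_tendsto_of_tendsto hlim1 hlim2 ?_
  filter_upwards [hux.eventually (Metric.ball_mem_nhds x (show 0 < δ / 4 by positivity))]
    with k hk using hnear _ (hu k) hk

end Displacement

/-! ### Transversality at regular values and the main theorem -/

section Main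

variable {d : ℕ}

/-- At every point of the sublevel set of a regular value there is a direction pointing inside. -/
theorem exists_transverse_direction {X : Set (EuclideanSpace ℝ (Fin d))}
    (hX : IsComplementaryRegular X) {τ : ℝ} (hτ : 0 < τ)
    {f : EuclideanSpace ℝ (Fin d) → ℝ} {c : ℝ} (hc : IsRegularValue f X c)
    {x : EuclideanSpace ℝ (Fin d)} (hx : x ∈ X) :
    ∃ w : EuclideanSpace ℝ (Fin d),
      (x ∈ cl_compl X → ∀ n ∈ proxNormal (cl_compl X) τ x, 0 < inner ℝ w n) ∧
      (f x = c → inner ℝ w (gradient f x) < 0) := by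
  have hXc := hX.isCompact.isClosed
  by_cases hxY : x ∈ cl_compl X
  · obtain ⟨μ, hμ, -, hreach⟩ := hX.muReach_pos
    obtain ⟨s, hs, hclarke⟩ := exists_real_of_muReach_pos ⟨x, hx⟩ hreach
    have h0 : (0 : EuclideanSpace ℝ (Fin d)) ∉ convexHull ℝ (proxNormal (cl_compl X) τ x) :=
      zero_notMem_convexHull_proxNormal hXc hs hμ hτ (fun z hz hzs =>
        exists_unit_inner_ge_of_le_minNorm hXc ⟨x, hx⟩ hμ hz (hclarke z hz hzs)) hx hxY
    have hP := isCompact_proxNormal (cl_compl X) τ x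
    by_cases hfx : f x = c
    · have hfr : x ∈ frontier X := by
        rw [frontier_eq_closure_inter_closure]; exact ⟨subset_closure hx, hxY⟩
      -- The sign in the normal cone cancels the one in the critical point condition, leaving
      -- membership of `∇f` itself in the polar cone.
      have hg : gradient f x ∉ tangentPolar (cl_compl X) x := fun hg => hc x hfx ⟨hx, by
        rw [normalCone, if_pos hfr]
        simpa using hg⟩
      obtain ⟨w, hw1, hw2⟩ := exists_inner_pos_inner_neg (g := gradient f x) hP h0
        (fun h => hg fun b _ => by rw [h, inner_zero_left]) fun m hm t ht h => hg fun b hb => by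
          rw [h, real_inner_smul_left]
          exact mul_nonpos_of_nonneg_of_nonpos ht (convexHull_min
            (proxNormal_subset_tangentPolar hτ x) (convex_tangentPolar _ _) hm b hb)
      exact ⟨w, fun _ => hw1, fun _ => hw2⟩
    · obtain ⟨w, hw⟩ := exists_inner_pos_of_zero_notMem_convexHull hP h0
      exact ⟨w, fun _ => hw, fun h => absurd h hfx⟩
  · refine ⟨-gradient f x, fun h => absurd h hxY, fun hfx => ?_⟩
    have hfr : x ∉ frontier X := by
      rw [frontier_eq_closure_inter_closure]; exact fun h => hxY h.2
    have hg : gradient f x ≠ 0 := fun hg => hc x hfx ⟨hx, by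
      rw [normalCone, if_neg hfr, hg]; simp⟩
    rw [inner_neg_left, real_inner_self_eq_norm_sq, neg_lt_zero]
    have := norm_pos_iff.2 hg
    positivity

theorem mem_counterOffset_iff {X : Set (EuclideanSpace ℝ (Fin d))} (hne : (cl_compl X).Nonempty)
    {r : ℝ} {x : EuclideanSpace ℝ (Fin d)} :
    x ∈ counterOffset X r ↔ r ≤ Metric.infDist x (cl_compl X) := by
  rw [counterOffset, mem_ofPred_eq, Metric.infDist,
    ENNReal.ofReal_le_iff_le_toReal (Metric.infEDist_ne_top hne)]

theorem sublevel_counterOffset_eq_of_subsingleton [Subsingleton (EuclideanSpace ℝ (Fin d))]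
    (X : Set (EuclideanSpace ℝ (Fin d))) (f : EuclideanSpace ℝ (Fin d) → ℝ)
    (η : EuclideanSpace ℝ (Fin d) → EuclideanSpace ℝ (Fin d)) (c : ℝ) {r : ℝ} (hr : 0 < r) :
    sublevel (counterOffset X r) (shifted f η r) c = sublevel X f c := by
  have h1 : shifted f η r = f := funext fun x => congrArg f (Subsingleton.elim _ _)
  have h2 : counterOffset X r = X := by
    rcases X.eq_empty_or_nonempty.imp id Subsingleton.eq_univ_of_nonempty with rfl | rfl
    · ext x; simp [counterOffset, cl_compl, Metric.infEDist_zero_of_mem, hr]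
    · ext x; simp [counterOffset, cl_compl]
  rw [h1, h2]

end Main

end ComplReg

open ComplReg

theorem mainTheorem8 (d : ℕ) (X : Set (EuclideanSpace ℝ (Fin d)))
    (hX : ComplReg.IsComplementaryRegular X)
    (f : EuclideanSpace ℝ (Fin d) → ℝ) (hf : ContDiff ℝ 2 f)
    (c : ℝ) (hc : ComplReg.IsRegularValue f X c)
    (η : EuclideanSpace ℝ (Fin d) → EuclideanSpace ℝ (Fin d)) (hη : ContDiff ℝ 2 η)
    (hη_le : ∀ x, ‖η x‖ ≤ 1) :
    ∃ r₀ : ℝ, 0 < r₀ ∧ ∀ r : ℝ, 0 < r → r < r₀ →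
      Nonempty (ContinuousMap.HomotopyEquiv
        (ComplReg.sublevel (ComplReg.counterOffset X r) (ComplReg.shifted f η r) c)
        (ComplReg.sublevel X f c)) := by
  -- With empty complement the whole space is compact, hence a point, and the two sets coincide.
  rcases (cl_compl X).eq_empty_or_nonempty with hY0 | hne
  · have hXu : X = univ := by
      rw [cl_compl, closure_empty_iff, compl_empty_iff] at hY0; exact hY0
    have : CompactSpace (EuclideanSpace ℝ (Fin d)) := ⟨hXu ▸ hX.isCompact⟩
    have : Subsingleton (EuclideanSpace ℝ (Fin d)) := by
      by_contra h
      rw [not_subsingleton_iff_nontrivial] at h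
      exact NormedSpace.noncompactSpace ℝ (EuclideanSpace ℝ (Fin d)) |>.1 isCompact_univ
    refine ⟨1, one_pos, fun r hr _ => ?_⟩
    rw [sublevel_counterOffset_eq_of_subsingleton X f η c hr]
    exact ⟨ContinuousMap.HomotopyEquiv.refl _⟩
  have hf1 : ContDiff ℝ 1 f := hf.of_le one_le_two
  have hη1 : ContDiff ℝ 1 η := hη.of_le one_le_two
  have hXc := hX.isCompact.isClosed
  have hYc : IsClosed (cl_compl X) := isClosed_closure
  obtain ⟨R, hR0, hR⟩ := exists_real_of_reach_pos hne hX.reach_compl_pos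
  have hτ : 0 < R / 2 := by positivity
  have hK : IsCompact (sublevel X f c) :=
    hX.isCompact.inter_right (isClosed_Iic.preimage hf.continuous)
  have hgc := continuous_gradient hf1
  obtain ⟨w, hw⟩ := exists_continuous_transverse hK.isClosed hYc (τ := R / 2) hf.continuous
    hgc (fun x hx => hx.2) fun x hx => exists_transverse_direction hX hτ hc hx.1
  obtain ⟨δ₁, hδ₁, hwY⟩ := exists_uniform_inner_proxNormal hK hYc w.continuous
    fun x hx => (hw x hx).1
  obtain ⟨δ₂, hδ₂, hwf⟩ := exists_uniform_inner_gradient hK hf.continuous hgc w.continuous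
    fun x hx => (hw x hx).2
  set δ := min (min δ₁ δ₂) 1 with hδdef
  have hδ : 0 < δ := by positivity
  have hδδ₁ : δ ≤ δ₁ := (min_le_left _ _).trans (min_le_left _ _)
  have hδδ₂ : δ ≤ δ₂ := (min_le_left _ _).trans (min_le_right _ _)
  have hδ1 : δ ≤ 1 := min_le_right _ _
  obtain ⟨ε, hε, hnear⟩ := exists_forall_dist_sublevel_lt hX.isCompact hf.continuous c hδ
  obtain ⟨M', hM'⟩ := hX.isCompact.exists_bound_of_continuousOn w.continuous.continuousOn
  obtain ⟨M, hM0, hM⟩ : ∃ M > 0, ∀ x ∈ X, ‖w x‖ ≤ M :=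
    ⟨max M' 1, by positivity, fun x hx => (hM' x hx).trans (le_max_left _ _)⟩
  obtain ⟨ρ, hρ⟩ : ∃ ρ, ∀ x ∈ X, ‖x‖ ≤ ρ := hX.isCompact.exists_bound_of_continuousOn
    continuous_id.continuousOn
  have hball : ∀ x ∈ X, ∀ z, dist z x ≤ 1 → z ∈ Metric.closedBall 0 (ρ + 1) := fun x hx z hz => by
    rw [Metric.mem_closedBall]
    have := dist_triangle z x 0
    rw [dist_zero_right x] at this
    linarith [hρ x hx]
  obtain ⟨L, hL0, hLd, hL⟩ := exists_lipschitz_bound_closedBall hf1 (ρ + 1)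
  obtain ⟨Λ, hΛ0, -, hΛ⟩ := exists_lipschitz_bound_closedBall hη1 (ρ + 1)
  -- At rate `δ / 2`, time `κ * r` gains `L * r + r`: `L * r` absorbs the gap between `f` and `f_r`,
  -- and `r` reaches the counter-offset.
  set κ := (L + 1) / (δ / 2) with hκ
  have hκ0 : 0 < κ := by positivity
  have hκδ : δ / 2 * κ = L + 1 := by rw [hκ]; field_simp
  -- In order, the bounds on `r` keep displacements and the resulting variation of `f` below `δ /
  -- 4`, keep `f ≤ c + L * r` within `ε` of `c`, let the variation of `η` cost at most half the
  -- descent rate `δ`, and put `r` below the level where the distance growth saturates.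
  refine ⟨min (min (δ / 4 / ((κ * M + 1) * (L + 1))) (ε / L))
    (min (δ / 2 / (L * Λ * M)) (min (δ / 4) (R / 2))), by positivity, fun r hr hr₀ => ?_⟩
  obtain ⟨⟨hr1, hr2⟩, hr3, hr4⟩ : (r < δ / 4 / ((κ * M + 1) * (L + 1)) ∧ r < ε / L) ∧
      r < δ / 2 / (L * Λ * M) ∧ r < min (δ / 4) (R / 2) := by
    simpa only [lt_min_iff] using hr₀
  rw [lt_div_iff₀ (by positivity)] at hr1 hr2 hr3
  have hκM : 0 < κ * M := by positivity
  have hsmall : κ * r * M + r < δ / 4 := by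
    have h1 : (κ * r * M + r) * 1 ≤ (κ * r * M + r) * (L + 1) := by
      gcongr; linarith
    linarith
  have hLsmall : L * (κ * r * M + r) < δ / 4 := by
    have h1 : 0 < κ * r * M + r := by positivity
    linarith
  have hdispl : ∀ x ∈ X, ∀ t ∈ Icc 0 (κ * r), ‖t • w x‖ ≤ κ * r * M := fun x hx t ht => by
    rw [norm_smul, Real.norm_of_nonneg ht.1]
    exact mul_le_mul ht.2 (hM x hx) (norm_nonneg _) (by positivity)
  have hshift : ∀ y, ∀ s ∈ Icc 0 r, ‖s • η y‖ ≤ s := fun y s hs => by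
    rw [norm_smul, Real.norm_of_nonneg hs.1]
    exact mul_le_of_le_one_right hs.1 (hη_le y)
  have hdist : ∀ x ∈ X, ∀ t ∈ Icc 0 (κ * r), ∀ s ∈ Icc 0 r,
      dist (x + t • w x + s • η (x + t • w x)) x ≤ κ * r * M + r := fun x hx t ht s hs => by
    rw [dist_eq_norm, add_assoc, add_sub_cancel_left]
    exact (norm_add_le _ _).trans (add_le_add (hdispl x hx t ht) ((hshift _ s hs).trans hs.2))
  have hdom : ∀ x ∈ X, ∀ t ∈ Icc 0 (κ * r), ∀ s ∈ Icc 0 r,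
      x + t • w x + s • η (x + t • w x) ∈ Metric.closedBall 0 (ρ + 1) := fun x hx t ht s hs =>
    hball x hx _ ((hdist x hx t ht s hs).trans (by linarith))
  have h0r : (0 : ℝ) ∈ Icc 0 r := ⟨le_rfl, hr.le⟩
  have hrr : r ∈ Icc 0 r := ⟨hr.le, le_rfl⟩
  have h0T : (0 : ℝ) ∈ Icc 0 (κ * r) := ⟨le_rfl, by positivity⟩
  have hTT : κ * r ∈ Icc 0 (κ * r) := ⟨by positivity, le_rfl⟩
  have hfr : ∀ x ∈ X, ∀ t ∈ Icc 0 (κ * r),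
      |shifted f η r (x + t • w x) - f (x + t • w x)| ≤ L * r := fun x hx t ht => by
    have h1 := hL _ (by simpa using hdom x hx t ht 0 h0r) _ (hdom x hx t ht r hrr)
    rw [add_sub_cancel_left] at h1
    exact h1.trans (mul_le_mul_of_nonneg_left (hshift _ r hrr) hL0.le)
  have hY : ∀ x ∈ X, f x ≤ c + L * r → ∀ t ∈ Icc 0 (κ * r),
      min (Metric.infDist x (cl_compl X) + δ / 2 * t) (min (δ / 4) (R / 2)) ≤
        Metric.infDist (x + t • w x) (cl_compl X) := fun x hx hfx => by
    obtain ⟨k, hk, hxk⟩ := hnear x hx (hfx.trans (by linarith))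
    refine infDist_compl_add_smul_ge hX.closure_interior hne hR hτ (half_lt_self hR0) hδ hx
      (fun p hp hpx n hn => hδδ₁.trans ?_) ?_
    · exact hwY k hk x (hxk.trans_le hδδ₁) p hp (hpx.trans_le hδδ₁) n hn
    · have := mul_le_mul_of_nonneg_left (hM x hx) hTT.1
      linarith
  -- The parameter `s` treats `f` (`s = 0`) and `f_r` (`s = r`) together. Near level `c` the value
  -- descends; otherwise `f x ≤ c - δ`, and the displacement is too short to exceed `c`.
  have hF : ∀ x ∈ X, f x ≤ c + L * r → ∀ t ∈ Icc 0 (κ * r),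
      (∀ s ∈ Icc 0 r, f (x + t • w x + s • η (x + t • w x)) ≤ f (x + s • η x) - δ / 2 * t) ∨
      ∀ s ∈ Icc 0 r, f (x + t • w x + s • η (x + t • w x)) ≤ c := by
    intro x hx hfx t ht
    rcases lt_or_ge |f x - c| δ with hlt | hge
    · left
      intro s hs
      obtain ⟨k, hk, hxk⟩ := hnear x hx (hfx.trans (by linarith))
      have h1 := le_sub_of_inner_gradient_le (hf1.differentiable one_ne_zero) (x := x) (w := w x)
        (e := s • (η (x + t • w x) - η x)) (z₀ := x + s • η x)
        (z₁ := x + t • w x + s • η (x + t • w x)) (δ := δ) (L := L) (t := t)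
        (fun z hz => (hwf k hk x (hxk.trans_le hδδ₂) (hlt.trans_le hδδ₂) z
          (hz.trans_le hδδ₂)).trans (neg_le_neg hδδ₂))
        (fun z hz => hLd z (hball x hx z (hz.le.trans hδ1)))
        (by simpa using (hdist x hx 0 h0T s hs).trans_lt (by linarith))
        ((hdist x hx t ht s hs).trans_lt (by linarith)) ht.1 (by rw [smul_sub]; abel)
      have h2 := hΛ x (hball x hx x (by simp)) (x + t • w x) (by simpa using hdom x hx t ht 0 h0r)
      rw [add_sub_cancel_left, norm_smul t, Real.norm_of_nonneg ht.1] at h2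
      have h3 : ‖s • (η (x + t • w x) - η x)‖ ≤ r * (Λ * (t * M)) := by
        rw [norm_smul, Real.norm_of_nonneg hs.1]
        refine mul_le_mul hs.2 (h2.trans ?_) (norm_nonneg _) hr.le
        have := mul_le_mul_of_nonneg_left (hM x hx) ht.1
        exact mul_le_mul_of_nonneg_left this hΛ0.le
      have h4 := mul_le_mul_of_nonneg_left h3 hL0.le
      have h5 := mul_le_mul_of_nonneg_right hr3.le ht.1
      linarith
    · right
      intro s hs
      have h1 : f x ≤ c - δ := by
        rcases le_abs.1 hge with h | h <;> linarith [mul_pos (mul_pos hκ0 hr) hM0,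
          mul_pos hL0 (mul_pos (mul_pos hκ0 hr) hM0)]
      have h2 := hL x (hball x hx x (by simp)) _ (hdom x hx t ht s hs)
      rw [← dist_eq_norm _ x] at h2
      have h3 := mul_le_mul_of_nonneg_left (hdist x hx t ht s hs) hL0.le
      have h4 := (le_abs_self _).trans h2
      linarith
  have hrate : δ / 2 * (κ * r) = L * r + r := by rw [← mul_assoc, hκδ]; ring
  have hmemX : ∀ y, 0 < Metric.infDist y (cl_compl X) → y ∈ X := fun y hy => by
    by_contra h
    exact absurd (Metric.infDist_zero_of_mem (subset_closure h : y ∈ cl_compl X)) hy.ne'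
  have hβ : 0 < min (δ / 4) (R / 2) := by positivity
  have hLr : 0 < L * r := by positivity
  have hoffset : ∀ x ∈ sublevel (counterOffset X r) (shifted f η r) c,
      r ≤ Metric.infDist x (cl_compl X) ∧ x ∈ X ∧ f x ≤ c + L * r := fun x hx => by
    have h1 := (mem_counterOffset_iff hne).1 hx.1
    have h2 := hmemX x (hr.trans_le h1)
    have h3 := hfr x h2 0 h0T
    rw [zero_smul, add_zero] at h3
    have h4 : shifted f η r x ≤ c := hx.2
    exact ⟨h1, h2, by linarith [neg_abs_le (shifted f η r x - f x)]⟩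
  refine nonempty_homotopyEquiv_of_displacement w.continuous hTT.1 (fun x hx t ht => ?_)
    (fun x hx => ?_) (fun x hx t ht => ?_) fun x hx => ?_
  · obtain ⟨h1, h2, h3⟩ := hoffset x hx
    refine ⟨(mem_counterOffset_iff hne).2 (le_trans (le_min ?_ hr4.le) (hY x h2 h3 t ht)), ?_⟩
    · have := mul_nonneg (half_pos hδ).le ht.1; linarith
    · have h4 : f (x + r • η x) ≤ c := hx.2
      have h5 := mul_nonneg (half_pos hδ).le ht.1
      rcases hF x h2 h3 t ht with h | h
      · exact (h r hrr).trans (by linarith)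
      · exact h r hrr
  · obtain ⟨h1, h2, h3⟩ := hoffset x hx
    refine ⟨hmemX _ (lt_of_lt_of_le (lt_min ?_ hβ) (hY x h2 h3 _ hTT)), ?_⟩
    · linarith
    · rcases hF x h2 h3 _ hTT with h | h
      · have h4 := h 0 h0r
        simp only [zero_smul, add_zero] at h4
        exact h4.trans (by linarith)
      · simpa using h 0 h0r
  · have h3 : f x ≤ c + L * r := by
      have : f x ≤ c := hx.2
      linarith
    refine ⟨?_, ?_⟩
    -- Time `0` is separate because `x` may be at distance `0` from the complement; for positive
    -- time the distance is positive, which forces membership in `X`.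
    · rcases ht.1.eq_or_lt with rfl | hpos
      · simpa using hx.1
      · refine hmemX _ (lt_of_lt_of_le (lt_min ?_ hβ) (hY x hx.1 h3 t ht))
        have := mul_pos (half_pos hδ) hpos
        have := Metric.infDist_nonneg (x := x) (s := cl_compl X)
        linarith
    · have h4 : f x ≤ c := hx.2
      have h5 := mul_nonneg (half_pos hδ).le ht.1
      rcases hF x hx.1 h3 t ht with h | h
      · have h6 := h 0 h0r
        simp only [zero_smul, add_zero] at h6
        exact h6.trans (by linarith)
      · simpa using h 0 h0r
  · have h4 : f x ≤ c := hx.2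
    have h3 : f x ≤ c + L * r := by linarith
    refine ⟨(mem_counterOffset_iff hne).2 (le_trans (le_min ?_ hr4.le) (hY x hx.1 h3 _ hTT)), ?_⟩
    · have := Metric.infDist_nonneg (x := x) (s := cl_compl X)
      linarith
    · rcases hF x hx.1 h3 _ hTT with h | h
      · have h5 := h r hrr
        have h6 := hfr x hx.1 0 h0T
        rw [zero_smul, add_zero] at h6
        have h7 := (le_abs_self _).trans h6
        exact h5.trans (by change shifted f η r x - _ ≤ c; linarith)
      · exact h r hrr
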